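/- Let $G$ be a discrete group acting from the left on a set $S$. Let $\mathbb I\subseteq S$ be a set of orbit representatives, so that $S=\coprod_{x\in\mathbb I}\mathrm{Orb}_x$ is the partition of $S$ into $G$-orbits, and for $x\in\mathbb I$ let $H_x:=\mathrm{Stab}_G(x)$. Let $\ell^1(G)$ be the convolution algebra of $G$ over $\mathbb C$. Regard $\ell^1(S)$ as a Banach $\ell^1(G)$-bimodule, with left action extending the action of $G$ on $S$ and with right action the augmentation action $\varphi\cdot f=\big(\sum_{g\in G}f(g)\big)\varphi$, and give the dual space $\ell^1(S)'$ the dual bimodule structure $(f\cdot\lambda)(\varphi)=\lambda(\varphi\cdot f)$, $(\lambda\cdot f)(\varphi)=\lambda(f\cdot\varphi)$. For a Banach algebra $A$ and a Banach $A$-bimodule $M$, let $C^n(A,M)$ be the Banach space of bounded $n$-linear maps from $A$ to $M$, with the Hochschild coboundary $\delta: C^n(A,M)\to C^{n+1}(A,M)$, $$(\delta\psi)(a_1,\dots,a_{n+1})=a_1\psi(a_2,\dots,a_{n+1})+\sum_{j=1}^n(-1)^j\psi(a_1,\dots,a_ja_{j+1},\dots,a_{n+1})+(-1)^{n+1}\psi(a_1,\dots,a_n)a_{n+1},$$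 and let $H^n(A,M)$ be the $n$th cohomology space of this complex, i.e. the cocycles modulo the coboundaries, with the quotient topology (not necessarily Hausdorff). Then for each $n\ge 0$, $H^n(\ell^1(G),\ell^1(S)')$ is topologically isomorphic (linearly homeomorphic) to the $n$th cohomology space, again with the quotient topology, of the complex $$0\to \bigoplus_{x\in\mathbb I}^{(\infty)} C^0(\ell^1(H_x),\mathbb C)\to \bigoplus_{x\in\mathbb I}^{(\infty)} C^1(\ell^1(H_x),\mathbb C)\to\cdots,$$ where $\bigoplus^{(\infty)}$ denotes the $\ell^\infty$-direct sum of Banach spaces (bounded families, with the supremum norm), the coboundary acts in each coordinate $x$ as the Hochschild coboundary of $C^*(\ell^1(H_x),\mathbb C)$, and $\mathbb C$ is the one-dimensional $\ell^1(H_x)$-bimodule on which $\ell^1(H_x)$ acts from both sides through the augmentation character $f\mapsto\sum_{h\in H_x} f(h)$. -/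

import Mathlib

open scoped ENNReal

/-! ### Cochain complexes of Banach spaces and their cohomology -/

/-- A cochain complex `0 → X 0 → X 1 → ⋯` of Banach spaces and bounded linear maps, with
underlying graded Banach space `X`. -/
structure BanachCochainComplex (X : ℕ → Type*) [∀ n, NormedAddCommGroup (X n)]
    [∀ n, NormedSpace ℂ (X n)] [∀ n, CompleteSpace (X n)] where
  /-- the coboundary operator -/
  d : ∀ n, X n →L[ℂ] X (n + 1)
  d_d : ∀ n x, d (n + 1) (d n x) = 0

namespace BanachCochainComplex

section Cohomology

variable {X : ℕ → Type*} [∀ n, NormedAddCommGroup (X n)] [∀ n, NormedSpace ℂ (X n)]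
  [∀ n, CompleteSpace (X n)] (K : BanachCochainComplex X)

/-- `n`-cocycles. -/
def cocycles (n : ℕ) : Submodule ℂ (X n) := LinearMap.ker (K.d n).toLinearMap

/-- `n`-coboundaries; there are no nonzero coboundaries in degree `0`. -/
def coboundaries : ∀ n : ℕ, Submodule ℂ (X n)
  | 0 => ⊥
  | n + 1 => LinearMap.range (K.d n).toLinearMap

theorem coboundaries_le_cocycles : ∀ n, K.coboundaries n ≤ K.cocycles n
  | 0 => bot_le
  | n + 1 => by
    rintro _ ⟨x, rfl⟩
    exact K.d_d n x

/-- The `n`th cohomology space, cocycles modulo coboundaries. As a type it is the quotient of the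
normed space of cocycles, so it carries the quotient topology (of the quotient seminorm),
which need not be Hausdorff. -/
abbrev Cohomology (n : ℕ) : Type _ :=
  K.cocycles n ⧸ (K.coboundaries n).submoduleOf (K.cocycles n)

end Cohomology

/-! ### `ℓ^∞`-sums of complexes -/

section LinftySum

/-- The `ℓ^∞`-sum of a uniformly bounded family of bounded linear maps. -/
noncomputable def linftyMap {ι : Type*} {E F : ι → Type*} [∀ i, NormedAddCommGroup (E i)]
    [∀ i, NormedSpace ℂ (E i)] [∀ i, NormedAddCommGroup (F i)] [∀ i, NormedSpace ℂ (F i)]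
    (T : ∀ i, E i →L[ℂ] F i) (hT : ∃ C : ℝ, ∀ i, ‖T i‖ ≤ C) : lp E ∞ →L[ℂ] lp F ∞ :=
  have key : ∀ C : ℝ, (∀ i, ‖T i‖ ≤ C) → ∀ (f : lp E ∞) (i : ι), ‖T i (f i)‖ ≤ |C| * ‖f‖ :=
    fun C hC f i => ((T i).le_opNorm _).trans
      (mul_le_mul ((hC i).trans (le_abs_self C)) (lp.norm_apply_le_norm ENNReal.top_ne_zero f i)
        (norm_nonneg _) (abs_nonneg _))
  LinearMap.mkContinuousOfExistsBound
    { toFun := fun f => ⟨fun i => T i (f i), memℓp_infty (by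
        obtain ⟨C, hC⟩ := hT
        exact ⟨|C| * ‖f‖, by rintro _ ⟨i, rfl⟩; exact key C hC f i⟩)⟩
      map_add' := fun f g => by ext i; exact map_add (T i) _ _
      map_smul' := fun c f => by ext i; exact map_smul (T i) _ _ }
    (by
      obtain ⟨C, hC⟩ := hT
      exact ⟨|C|, fun f => lp.norm_le_of_forall_le (by positivity) fun i => key C hC f i⟩)

@[simp]
theorem linftyMap_apply {ι : Type*} {E F : ι → Type*} [∀ i, NormedAddCommGroup (E i)]
    [∀ i, NormedSpace ℂ (E i)] [∀ i, NormedAddCommGroup (F i)] [∀ i, NormedSpace ℂ (F i)]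
    (T : ∀ i, E i →L[ℂ] F i) (hT : ∃ C : ℝ, ∀ i, ‖T i‖ ≤ C) (f : lp E ∞) (i : ι) :
    linftyMap T hT f i = T i (f i) := rfl

/-- The `ℓ^∞`-sum of a family of cochain complexes of Banach spaces whose coboundary operators are
uniformly bounded in each degree. -/
noncomputable def linftySum {ι : Type*} {X : ι → ℕ → Type*} [∀ i n, NormedAddCommGroup (X i n)]
    [∀ i n, NormedSpace ℂ (X i n)] [∀ i n, CompleteSpace (X i n)]
    (K : ∀ i, BanachCochainComplex (X i)) (hK : ∀ n, ∃ C : ℝ, ∀ i, ‖(K i).d n‖ ≤ C) :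
    BanachCochainComplex (fun n => lp (fun i => X i n) ∞) where
  d n := linftyMap (fun i => (K i).d n) (hK n)
  d_d n f := by ext i; exact (K i).d_d n (f i)

end LinftySum

end BanachCochainComplex

/-! ### Banach bimodules -/

/-- A Banach `A`-bimodule structure on `M`, given by two commuting, jointly continuous bilinear
actions: `left a m` is `a · m` and `right a m` is `m · a`. -/
structure BanachBimodule (A M : Type*) [NormedRing A] [NormedAlgebra ℂ A]
    [NormedAddCommGroup M] [NormedSpace ℂ M] where
  left : A →L[ℂ] M →L[ℂ] M
  right : A →L[ℂ] M →L[ℂ] M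
  left_mul : ∀ a b m, left (a * b) m = left a (left b m)
  right_mul : ∀ a b m, right (a * b) m = right b (right a m)
  left_right : ∀ a b m, right b (left a m) = left a (right b m)

namespace BanachBimodule

variable {A M : Type*} [NormedRing A] [NormedAlgebra ℂ A]
  [NormedAddCommGroup M] [NormedSpace ℂ M]

/-- The dual bimodule: `(a · φ)(m) = φ(m · a)` and `(φ · a)(m) = φ(a · m)`. -/
noncomputable def dual (B : BanachBimodule A M) : BanachBimodule A (M →L[ℂ] ℂ) where
  left := (ContinuousLinearMap.compL ℂ M M ℂ).flip ∘L B.right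
  right := (ContinuousLinearMap.compL ℂ M M ℂ).flip ∘L B.left
  left_mul a b φ := by ext m; exact congrArg φ (B.right_mul a b m)
  right_mul a b φ := by ext m; exact congrArg φ (B.left_mul a b m)
  left_right a b φ := by ext m; exact congrArg φ (B.left_right b a m)

@[simp]
theorem dual_left_apply (B : BanachBimodule A M) (a : A) (φ : M →L[ℂ] ℂ) (m : M) :
    B.dual.left a φ m = φ (B.right a m) := rfl

@[simp]
theorem dual_right_apply (B : BanachBimodule A M) (a : A) (φ : M →L[ℂ] ℂ) (m : M) :
    B.dual.right a φ m = φ (B.left a m) := rfl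

/-- The one-dimensional bimodule `ℂ_χ` of a continuous character `χ`. -/
noncomputable def ofCharacter (χ : A →L[ℂ] ℂ) (hχ : ∀ a b, χ (a * b) = χ a * χ b) :
    BanachBimodule A ℂ where
  left := ContinuousLinearMap.mul ℂ ℂ ∘L χ
  right := ContinuousLinearMap.mul ℂ ℂ ∘L χ
  left_mul a b m := by simp [hχ, mul_assoc]
  right_mul a b m := by simp [hχ, mul_assoc, mul_left_comm]
  left_right a b m := by simp [mul_left_comm]

@[simp]
theorem ofCharacter_left_apply (χ : A →L[ℂ] ℂ) (hχ) (a : A) (z : ℂ) :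
    (ofCharacter χ hχ).left a z = χ a * z := rfl

@[simp]
theorem ofCharacter_right_apply (χ : A →L[ℂ] ℂ) (hχ) (a : A) (z : ℂ) :
    (ofCharacter χ hχ).right a z = χ a * z := rfl

end BanachBimodule

/-! ### The Hochschild cochain complex -/

namespace Hochschild

variable {A M : Type*} [NormedRing A] [NormedAlgebra ℂ A]
  [NormedAddCommGroup M] [NormedSpace ℂ M]

/-- `C^n(A, M)`: bounded `n`-linear maps `A × ⋯ × A → M`. -/
abbrev Cochain (A M : Type*) [NormedRing A] [NormedAlgebra ℂ A]
    [NormedAddCommGroup M] [NormedSpace ℂ M] (n : ℕ) : Type _ :=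
  ContinuousMultilinearMap ℂ (fun _ : Fin n => A) M

/-- `(a₁, …, aₙ₊₁) ↦ a₁ · ψ(a₂, …, aₙ₊₁)`. -/
noncomputable def firstTerm (B : BanachBimodule A M) {n : ℕ} (ψ : Cochain A M n) :
    Cochain A M (n + 1) :=
  (((ContinuousLinearMap.compContinuousMultilinearMapL ℂ (fun _ : Fin n => A) M M).flip ψ) ∘L
    B.left).uncurryLeft

@[simp]
theorem firstTerm_apply (B : BanachBimodule A M) {n : ℕ} (ψ : Cochain A M n)
    (a : Fin (n + 1) → A) : firstTerm B ψ a = B.left (a 0) (ψ (Fin.tail a)) := rfl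

/-- `(a₁, …, aₙ₊₁) ↦ ψ(a₁, …, aₙ) · aₙ₊₁`. -/
noncomputable def lastTerm (B : BanachBimodule A M) {n : ℕ} (ψ : Cochain A M n) :
    Cochain A M (n + 1) :=
  ContinuousMultilinearMap.uncurryRight (B.right.flip.compContinuousMultilinearMap ψ)

@[simp]
theorem lastTerm_apply (B : BanachBimodule A M) {n : ℕ} (ψ : Cochain A M n)
    (a : Fin (n + 1) → A) :
    lastTerm B ψ a = B.right (a (Fin.last n)) (ψ (Fin.init a)) := rfl

theorem contractNth_castSucc {R : Type*} [Mul R] {n : ℕ} (j : Fin n) (a : Fin (n + 1) → R) (k : Fin n) :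
    j.castSucc.contractNth (· * ·) a k =
      if k = j then a j.castSucc * a (j.castSucc.succAbove k)
      else a (j.castSucc.succAbove k) := by
  split_ifs with h
  · subst h
    simp [Fin.contractNth]
  · exact Fin.contractNth_apply_of_ne _ _ _ _ (fun h' => h (Fin.ext h'.symm))

theorem contractNth_update {n : ℕ} (j : Fin n) (a : Fin (n + 1) → A) (i : Fin (n + 1)) :
    ∃ (k : Fin n) (F : A →ₗ[ℂ] A), ∀ v,
      j.castSucc.contractNth (· * ·) (Function.update a i v) =
        Function.update (j.castSucc.contractNth (· * ·) a) k (F v) := by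
  rcases Fin.eq_self_or_eq_succAbove j.castSucc i with rfl | ⟨m, rfl⟩
  · refine ⟨j, LinearMap.mulRight ℂ (a j.succ), fun v => ?_⟩
    ext k
    rw [contractNth_castSucc]
    by_cases hk : k = j
    · subst hk
      rw [if_pos rfl, Function.update_self, Function.update_self, Fin.succAbove_castSucc_self,
        Function.update_of_ne (Fin.castSucc_lt_succ).ne']
      rfl
    · simp [hk, contractNth_castSucc, Fin.succAbove_ne]
  · by_cases hm : m = j
    · subst hm
      refine ⟨m, LinearMap.mulLeft ℂ (a m.castSucc), fun v => ?_⟩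
      ext k
      rw [contractNth_castSucc]
      by_cases hk : k = m
      · subst hk
        rw [if_pos rfl, Function.update_self, Function.update_self,
          Function.update_of_ne (Fin.succAbove_ne _ _).symm]
        rfl
      · rw [if_neg hk, Function.update_of_ne hk, contractNth_castSucc, if_neg hk,
          Function.update_of_ne]
        exact fun h => hk (Fin.succAbove_right_injective h)
    · refine ⟨m, LinearMap.id, fun v => ?_⟩
      ext k
      rw [contractNth_castSucc]
      by_cases hk : k = j
      · subst hk
        rw [if_pos rfl, Function.update_of_ne (Fin.succAbove_ne _ _).symm,
          Function.update_of_ne (Ne.symm hm), contractNth_castSucc, if_pos rfl,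
          Function.update_of_ne]
        exact fun h => hm (Fin.succAbove_right_injective h).symm
      · rw [if_neg hk]
        by_cases hkm : k = m
        · subst hkm
          simp
        · rw [Function.update_of_ne hkm, contractNth_castSucc, if_neg hk, Function.update_of_ne]
          exact fun h => hkm (Fin.succAbove_right_injective h)

/-- `(a₁, …, aₙ₊₁) ↦ ψ(a₁, …, aⱼ aⱼ₊₁, …, aₙ₊₁)` (the index `j` is zero-based). -/
noncomputable def mulTerm {n : ℕ} (j : Fin n) (ψ : Cochain A M n) : Cochain A M (n + 1) where
  toFun a := ψ (j.castSucc.contractNth (· * ·) a)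
  map_update_add' {inst} a i x y := by
    obtain rfl : inst = instDecidableEqFin _ := Subsingleton.elim _ _
    obtain ⟨k, F, hF⟩ := contractNth_update j a i
    simp only [hF, map_add, ContinuousMultilinearMap.map_update_add]
  map_update_smul' {inst} a i c x := by
    obtain rfl : inst = instDecidableEqFin _ := Subsingleton.elim _ _
    obtain ⟨k, F, hF⟩ := contractNth_update j a i
    simp only [hF, map_smul, ContinuousMultilinearMap.map_update_smul]
  cont := by
    refine ψ.cont.comp (continuous_pi fun k => ?_)
    simp only [contractNth_castSucc]
    split_ifs <;> fun_prop

@[simp]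
theorem mulTerm_apply {n : ℕ} (j : Fin n) (ψ : Cochain A M n) (a : Fin (n + 1) → A) :
    mulTerm j ψ a = ψ (j.castSucc.contractNth (· * ·) a) := rfl

theorem norm_firstTerm_le (B : BanachBimodule A M) {n : ℕ} (ψ : Cochain A M n) :
    ‖firstTerm B ψ‖ ≤ ‖B.left‖ * ‖ψ‖ := by
  refine ContinuousMultilinearMap.opNorm_le_bound (by positivity) fun a => ?_
  rw [firstTerm_apply, Fin.prod_univ_succ]
  calc ‖B.left (a 0) (ψ (Fin.tail a))‖ ≤ ‖B.left‖ * ‖a 0‖ * ‖ψ (Fin.tail a)‖ :=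
        B.left.le_opNorm₂ _ _
    _ ≤ ‖B.left‖ * ‖a 0‖ * (‖ψ‖ * ∏ i, ‖Fin.tail a i‖) := by
        gcongr
        exact ψ.le_opNorm _
    _ = _ := by simp only [Fin.tail]; ring

theorem norm_lastTerm_le (B : BanachBimodule A M) {n : ℕ} (ψ : Cochain A M n) :
    ‖lastTerm B ψ‖ ≤ ‖B.right‖ * ‖ψ‖ := by
  refine ContinuousMultilinearMap.opNorm_le_bound (by positivity) fun a => ?_
  rw [lastTerm_apply, Fin.prod_univ_castSucc]
  calc ‖B.right (a (Fin.last n)) (ψ (Fin.init a))‖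
      ≤ ‖B.right‖ * ‖a (Fin.last n)‖ * ‖ψ (Fin.init a)‖ := B.right.le_opNorm₂ _ _
    _ ≤ ‖B.right‖ * ‖a (Fin.last n)‖ * (‖ψ‖ * ∏ i, ‖Fin.init a i‖) := by
        gcongr
        exact ψ.le_opNorm _
    _ = _ := by simp only [Fin.init]; ring

theorem norm_mulTerm_le {n : ℕ} (j : Fin n) (ψ : Cochain A M n) :
    ‖mulTerm j ψ‖ ≤ ‖ψ‖ := by
  refine ContinuousMultilinearMap.opNorm_le_bound (norm_nonneg _) fun a => ?_
  rw [mulTerm_apply]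
  refine (ψ.le_opNorm _).trans (mul_le_mul_of_nonneg_left ?_ (norm_nonneg _))
  rw [Fin.prod_univ_succAbove (fun i => ‖a i‖) j.castSucc]
  calc ∏ k, ‖j.castSucc.contractNth (· * ·) a k‖
      ≤ ∏ k, (if k = j then ‖a j.castSucc‖ else 1) * ‖a (j.castSucc.succAbove k)‖ := by
        refine Finset.prod_le_prod (fun _ _ => norm_nonneg _) fun k _ => ?_
        rw [contractNth_castSucc]
        split_ifs
        · exact norm_mul_le _ _
        · simp
    _ = _ := by rw [Finset.prod_mul_distrib]; simp

/-- The Hochschild coboundary as a linear map. -/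
noncomputable def dLinear (B : BanachBimodule A M) (n : ℕ) :
    Cochain A M n →ₗ[ℂ] Cochain A M (n + 1) where
  toFun ψ := firstTerm B ψ + ∑ j : Fin n, (-1 : ℂ) ^ ((j : ℕ) + 1) • mulTerm j ψ +
    (-1 : ℂ) ^ (n + 1) • lastTerm B ψ
  map_add' ψ ψ' := by
    ext a
    simp [Finset.sum_add_distrib, smul_add]
    abel
  map_smul' c ψ := by
    ext a
    simp [Finset.smul_sum, smul_add, smul_comm c]

theorem norm_dLinear_le (B : BanachBimodule A M) (n : ℕ) (ψ : Cochain A M n) :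
    ‖dLinear B n ψ‖ ≤ (‖B.left‖ + n + ‖B.right‖) * ‖ψ‖ := by
  refine (norm_add₃_le).trans ?_
  rw [add_mul, add_mul]
  gcongr
  · exact norm_firstTerm_le B ψ
  · refine (norm_sum_le _ _).trans ?_
    calc ∑ j : Fin n, ‖(-1 : ℂ) ^ ((j : ℕ) + 1) • mulTerm j ψ‖ ≤ ∑ _j : Fin n, ‖ψ‖ :=
          Finset.sum_le_sum fun j _ => by
            rw [norm_smul]
            simpa using norm_mulTerm_le j ψ
      _ = n * ‖ψ‖ := by simp
  · rw [norm_smul]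
    simpa using norm_lastTerm_le B ψ

/-- The Hochschild coboundary `C^n(A, M) → C^{n+1}(A, M)`. -/
noncomputable def d (B : BanachBimodule A M) (n : ℕ) : Cochain A M n →L[ℂ] Cochain A M (n + 1) :=
  (dLinear B n).mkContinuous (‖B.left‖ + n + ‖B.right‖) (norm_dLinear_le B n)

theorem d_apply (B : BanachBimodule A M) (n : ℕ) (ψ : Cochain A M n) (a : Fin (n + 1) → A) :
    d B n ψ a = B.left (a 0) (ψ (Fin.tail a)) +
      ∑ j : Fin n, (-1 : ℂ) ^ ((j : ℕ) + 1) • ψ (j.castSucc.contractNth (· * ·) a) +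
      (-1 : ℂ) ^ (n + 1) • B.right (a (Fin.last n)) (ψ (Fin.init a)) := by
  simp [d, dLinear]

theorem norm_d_le (B : BanachBimodule A M) (n : ℕ) : ‖d B n‖ ≤ ‖B.left‖ + n + ‖B.right‖ :=
  LinearMap.mkContinuous_norm_le _ (by positivity) _

/-- The summands of the Hochschild coboundary, indexed by natural numbers. -/
noncomputable def coface (B : BanachBimodule A M) {n : ℕ} (j : ℕ) (ψ : (Fin n → A) → M)
    (a : Fin (n + 1) → A) : M :=
  if j = 0 then B.left (a 0) (ψ (Fin.tail a))
  else if h : j - 1 < n then ψ ((Fin.castSucc ⟨j - 1, h⟩).contractNth (· * ·) a)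
  else B.right (a (Fin.last n)) (ψ (Fin.init a))

theorem coface_sum (B : BanachBimodule A M) {n : ℕ} (j : ℕ) (s : Finset ℕ) (c : ℕ → ℂ)
    (F : ℕ → (Fin n → A) → M) (a : Fin (n + 1) → A) :
    coface B j (fun b => ∑ i ∈ s, c i • F i b) a = ∑ i ∈ s, c i • coface B j (F i) a := by
  unfold coface
  split_ifs <;> simp

theorem coface_coface (B : BanachBimodule A M) {n : ℕ} (ψ : (Fin n → A) → M)
    (a : Fin (n + 2) → A) (i j : ℕ) (hij : i < j) (hj : j < n + 3) :
    coface B j (coface B i ψ) a = coface B i (coface B (j - 1) ψ) a := by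
  obtain ⟨j, rfl⟩ : ∃ k, j = k + 1 := ⟨j - 1, by omega⟩
  rw [Nat.add_sub_cancel]
  rcases Nat.eq_zero_or_pos i with rfl | hi0
  · rcases Nat.eq_zero_or_pos j with rfl | hj0
    · simp only [coface, if_true, Nat.zero_add, one_ne_zero, if_false, Nat.sub_self, Nat.zero_lt_succ, dif_pos]
      have h0 : (Fin.castSucc (⟨0, Nat.zero_lt_succ n⟩ : Fin (n + 1))).contractNth (· * ·) a 0
          = a 0 * a 1 := by simp [Fin.contractNth]
      rw [h0, B.left_mul]
      congr 3
    · by_cases hjn : j < n + 1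
      · have h1 : j - 1 < n := by omega
        simp only [coface, Nat.succ_ne_zero, hj0.ne', if_true, if_false, Nat.add_sub_cancel, hjn, h1,
          dif_pos]
        congr 1
        · congr 1
          simp [Fin.contractNth, hj0]
        · congr 1
          funext k
          simp only [Fin.contractNth, Fin.tail, Fin.val_succ, Fin.val_castSucc]
          split_ifs <;> first | rfl | omega
      · have h1 : ¬ j - 1 < n := by omega
        simp only [coface, Nat.succ_ne_zero, hj0.ne', if_true, if_false, Nat.add_sub_cancel, hjn, h1,
          dif_neg, not_false_eq_true]
        rw [B.left_right]
        rfl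
  · obtain ⟨i, rfl⟩ : ∃ k, i = k + 1 := ⟨i - 1, by omega⟩
    have hj0 : j ≠ 0 := by omega
    by_cases hjn : j < n + 1
    · have h1 : j - 1 < n := by omega
      have h2 : i < n := by omega
      have h3 : i < n + 1 := by omega
      simp only [coface, Nat.succ_ne_zero, hj0, if_false, Nat.add_sub_cancel, hjn, h1, h2, h3,
        dif_pos]
      congr 1
      funext k
      simp only [Fin.contractNth, Fin.val_succ, Fin.val_castSucc]
      split_ifs <;> first | rfl | omega | exact (mul_assoc (_ : A) _ _).symm
    · have h1 : ¬ j - 1 < n := by omega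
      obtain rfl : j = n + 1 := by omega
      by_cases hin : i < n
      · have h3 : i < n + 1 := by omega
        simp only [coface, Nat.succ_ne_zero, if_false, Nat.add_sub_cancel, hin, h3,
          dif_pos, lt_irrefl, dif_neg, not_false_eq_true]
        congr 2
        simp only [Fin.contractNth, Fin.val_last, Fin.val_castSucc]
        split_ifs <;> first | rfl | omega
      · obtain rfl : i = n := by omega
        simp only [coface, Nat.succ_ne_zero, if_false, Nat.add_sub_cancel, Nat.lt_succ_self,
          dif_pos, lt_irrefl, dif_neg, not_false_eq_true]
        have h0 : (Fin.castSucc (⟨i, Nat.lt_succ_self i⟩ : Fin (i + 1))).contractNth (· * ·) a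
          (Fin.last i) = a (Fin.castSucc (Fin.last i)) * a (Fin.last (i + 1)) := by
            simp [Fin.contractNth]
        rw [h0, B.right_mul]
        congr 3
        funext k
        simp [Fin.contractNth, Fin.init]

/-- The cancellation behind `d ∘ d = 0`. -/
theorem alternating_double_sum_eq_zero (n : ℕ) (f : ℕ → ℕ → M)
    (hf : ∀ i j, i < j → j < n + 3 → f j i = f i (j - 1)) :
    ∑ j ∈ Finset.range (n + 3), (-1 : ℂ) ^ j • ∑ i ∈ Finset.range (n + 2), (-1 : ℂ) ^ i • f j i
      = 0 := by
  simp only [Finset.smul_sum, smul_smul, ← pow_add]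
  rw [← Finset.sum_product']
  refine Finset.sum_involution
    (fun p _ => if p.2 < p.1 then (p.2, p.1 - 1) else (p.2 + 1, p.1)) ?_ ?_ ?_ ?_
  · rintro ⟨j, i⟩ h
    simp only [Finset.mem_product, Finset.mem_range] at h
    dsimp only
    split_ifs with hij
    · obtain ⟨j, rfl⟩ : ∃ k, j = k + 1 := ⟨j - 1, by omega⟩
      simp only
      rw [hf i (j + 1) hij h.1, Nat.add_sub_cancel, ← add_smul]
      convert zero_smul ℂ _ using 2
      ring
    · simp only
      rw [hf j (i + 1) (by omega) (by omega), Nat.add_sub_cancel, ← add_smul]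
      convert zero_smul ℂ _ using 2
      ring
  · rintro ⟨j, i⟩ h _
    dsimp only
    split_ifs with hij <;> simp only [ne_eq, Prod.mk.injEq] <;> omega
  · rintro ⟨j, i⟩ h
    simp only [Finset.mem_product, Finset.mem_range] at h ⊢
    split_ifs with hij <;> dsimp only <;> omega
  · rintro ⟨j, i⟩ h
    dsimp only
    by_cases hij : i < j
    · rw [if_pos hij, if_neg (show ¬ j - 1 < i by omega)]
      exact Prod.ext (show j - 1 + 1 = j by omega) rfl
    · rw [if_neg hij, if_pos (show j < i + 1 by omega)]
      exact Prod.ext rfl (show i + 1 - 1 = i by omega)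

theorem d_d (B : BanachBimodule A M) (n : ℕ) (ψ : Cochain A M n) : d B (n + 1) (d B n ψ) = 0 := by
  ext a
  have h : ∀ {m : ℕ} (φ : Cochain A M m) (b : Fin (m + 1) → A), d B m φ b =
      ∑ j ∈ Finset.range (m + 2), (-1 : ℂ) ^ j • coface B j φ b := by
    intro m φ b
    rw [d_apply, Finset.sum_range_succ, Finset.sum_range_succ',
      ← Fin.sum_univ_eq_sum_range (fun j => (-1 : ℂ) ^ (j + 1) • coface B (j + 1) φ b) m]
    simp [coface, add_comm]
  have h' : (⇑(d B n ψ)) = fun b => ∑ j ∈ Finset.range (n + 2), (-1 : ℂ) ^ j • coface B j ψ b :=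
    funext fun b => h ψ b
  rw [h, h']
  simp only [coface_sum]
  exact alternating_double_sum_eq_zero n _ fun i j => coface_coface B ψ a i j

/-- The Hochschild cochain complex `C^*(A, M)`. -/
noncomputable def complex [CompleteSpace M] (B : BanachBimodule A M) :
    BanachCochainComplex (Cochain A M) where
  d := d B
  d_d := d_d B

end Hochschild

/-! ### The group algebra `ℓ¹(G)` and its modules -/

/-- `ℓ¹(X)` for a set `X`. -/
abbrev l1 (X : Type*) : Type _ := lp (fun _ : X => ℂ) 1

namespace l1

theorem summable_norm {X : Type*} (f : l1 X) : Summable fun x => ‖f x‖ := by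
  simpa using (lp.memℓp f).summable (by simp)

theorem norm_eq_tsum {X : Type*} (f : l1 X) : ‖f‖ = ∑' x, ‖f x‖ := by
  simp [lp.norm_eq_tsum_rpow (p := 1) (by simp) f]

theorem summable_smul {X E : Type*} [NormedAddCommGroup E] [NormedSpace ℂ E] [CompleteSpace E]
    (v : X → E) (C : ℝ) (hv : ∀ x, ‖v x‖ ≤ C) (f : l1 X) : Summable fun x => f x • v x := by
  refine Summable.of_norm_bounded ((summable_norm f).mul_left C) fun x => ?_
  rw [norm_smul, mul_comm]
  exact mul_le_mul_of_nonneg_right (hv x) (norm_nonneg _)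

/-- The bounded linear map `ℓ¹(X) → E`, `f ↦ ∑ₓ f(x) v(x)`, for a bounded function `v`. -/
noncomputable def lift {X E : Type*} [NormedAddCommGroup E] [NormedSpace ℂ E] [CompleteSpace E]
    (v : X → E) (C : ℝ) (hv : ∀ x, ‖v x‖ ≤ C) : l1 X →L[ℂ] E :=
  LinearMap.mkContinuous
    { toFun := fun f => ∑' x, f x • v x
      map_add' := fun f g => by
        simp only [lp.coeFn_add, Pi.add_apply, add_smul]
        exact (summable_smul v C hv f).tsum_add (summable_smul v C hv g)
      map_smul' := fun c f => by
        simp only [lp.coeFn_smul, Pi.smul_apply, smul_assoc, RingHom.id_apply]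
        exact (summable_smul v C hv f).tsum_const_smul c } C (by
        intro f
        have h := (summable_norm f).mul_left C
        rw [norm_eq_tsum, ← tsum_mul_left]
        refine tsum_of_norm_bounded h.hasSum fun x => ?_
        rw [norm_smul, mul_comm]
        exact mul_le_mul_of_nonneg_right (hv x) (norm_nonneg _))

theorem lift_apply {X E : Type*} [NormedAddCommGroup E] [NormedSpace ℂ E] [CompleteSpace E]
    (v : X → E) (C : ℝ) (hv : ∀ x, ‖v x‖ ≤ C) (f : l1 X) : lift v C hv f = ∑' x, f x • v x := rfl

theorem norm_lift_le {X E : Type*} [NormedAddCommGroup E] [NormedSpace ℂ E] [CompleteSpace E]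
    (v : X → E) {C : ℝ} (hC : 0 ≤ C) (hv : ∀ x, ‖v x‖ ≤ C) : ‖lift v C hv‖ ≤ C :=
  LinearMap.mkContinuous_norm_le _ hC _

theorem lift_single {X E : Type*} [DecidableEq X] [NormedAddCommGroup E] [NormedSpace ℂ E]
    [CompleteSpace E] (v : X → E) (C : ℝ) (hv : ∀ x, ‖v x‖ ≤ C) (x : X) (c : ℂ) :
    lift v C hv (lp.single 1 x c) = c • v x := by
  rw [lift_apply, tsum_eq_single x]
  · simp
  · intro y hy
    simp [Pi.single_eq_of_ne hy]

/-- Translation of functions on a `G`-set: `(g · f)(s) = f(g⁻¹ · s)`. -/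
noncomputable def translate {G S : Type*} [Group G] [MulAction G S] (g : G) : l1 S →L[ℂ] l1 S :=
  LinearMap.mkContinuous
    { toFun := fun f => ⟨fun s => f (g⁻¹ • s), memℓp_gen (by
        simpa [Function.comp_def] using (MulAction.toPerm g⁻¹).summable_iff.2 (summable_norm f))⟩
      map_add' := fun f h => by ext s; rfl
      map_smul' := fun c f => by ext s; rfl } 1 (by
        intro f
        rw [one_mul, norm_eq_tsum, norm_eq_tsum f]
        exact ((MulAction.toPerm g⁻¹).tsum_eq fun s => ‖f s‖).le)

@[simp]
theorem translate_apply {G S : Type*} [Group G] [MulAction G S] (g : G) (f : l1 S) (s : S) :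
    translate g f s = f (g⁻¹ • s) := rfl

theorem translate_single {G S : Type*} [Group G] [MulAction G S] [DecidableEq S] (g : G) (s : S)
    (c : ℂ) : translate g (lp.single 1 s c) = lp.single 1 (g • s) c := by
  ext t
  simp [Pi.single_apply, inv_smul_eq_iff]

theorem norm_translate_le {G S : Type*} [Group G] [MulAction G S] (g : G) :
    ‖(translate g : l1 S →L[ℂ] l1 S)‖ ≤ 1 :=
  LinearMap.mkContinuous_norm_le _ zero_le_one _

/-- The action of `ℓ¹(G)` on `ℓ¹(S)` that extends the action of `G` on `S`. -/
noncomputable def act (G S : Type*) [Group G] [MulAction G S] : l1 G →L[ℂ] l1 S →L[ℂ] l1 S :=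
  lift translate 1 norm_translate_le

theorem act_apply {G S : Type*} [Group G] [MulAction G S] (f : l1 G) (φ : l1 S) (s : S) :
    act G S f φ s = ∑' g, f g * φ (g⁻¹ • s) := by
  have h := summable_smul (translate : G → l1 S →L[ℂ] l1 S) 1 norm_translate_le f
  have h2 := (h.hasSum.mapL (ContinuousLinearMap.apply ℂ (l1 S) φ)).mapL
    (lp.evalCLM ℂ (fun _ : S => ℂ) 1 s)
  exact h2.tsum_eq.symm

theorem act_single {G S : Type*} [Group G] [MulAction G S] [DecidableEq G] [DecidableEq S]
    (g : G) (s : S) (c c' : ℂ) :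
    act G S (lp.single 1 g c) (lp.single 1 s c') = lp.single 1 (g • s) (c * c') := by
  rw [act, lift_single, smul_apply, translate_single, ← lp.single_smul,
    smul_eq_mul]

theorem norm_act_le (G S : Type*) [Group G] [MulAction G S] : ‖act G S‖ ≤ 1 :=
  norm_lift_le _ zero_le_one _

theorem act_act {G S : Type*} [Group G] [MulAction G S] (f h : l1 G) (φ : l1 S) :
    act G S (act G G f h) φ = act G S f (act G S h φ) := by
  classical
  have key : ((ContinuousLinearMap.compL ℂ (l1 G) (l1 G) (l1 S →L[ℂ] l1 S)) (act G S)) ∘L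
      (act G G) = ((ContinuousLinearMap.compL ℂ (l1 G) (l1 S →L[ℂ] l1 S) (l1 S →L[ℂ] l1 S)).flip
        (act G S)) ∘L (ContinuousLinearMap.compL ℂ (l1 S) (l1 S) (l1 S)) ∘L (act G S) := by
    refine lp.ext_continuousLinearMap ENNReal.one_ne_top fun g => ?_
    ext1
    refine lp.ext_continuousLinearMap ENNReal.one_ne_top fun g' => ?_
    ext1
    refine lp.ext_continuousLinearMap ENNReal.one_ne_top fun s => ?_
    ext1
    simp [lp.singleContinuousLinearMap_apply, act_single, mul_smul]
  exact congrArg (fun T => T f h φ) key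

theorem single_one_act {G : Type*} [Group G] [DecidableEq G] (f : l1 G) :
    act G G (lp.single 1 1 1) f = f := by
  ext x
  rw [act_apply, tsum_eq_single 1]
  · simp
  · intro y hy
    simp [Pi.single_eq_of_ne hy]

theorem act_single_one {G : Type*} [Group G] [DecidableEq G] (f : l1 G) :
    act G G f (lp.single 1 1 1) = f := by
  ext x
  rw [act_apply, tsum_eq_single x]
  · simp
  · intro y hy
    have : y⁻¹ * x ≠ 1 := fun h => hy (inv_mul_eq_one.1 h)
    simp [Pi.single_eq_of_ne this]

/-- `ℓ¹(G)` is a unital Banach algebra under convolution, `(f * h)(x) = ∑ g, f(g) h(g⁻¹ x)`. -/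
noncomputable instance instNormedRing (G : Type*) [Group G] : NormedRing (l1 G) :=
  { (inferInstance : NormedAddCommGroup (l1 G)) with
    mul := fun f h => act G G f h
    left_distrib := fun f h k => map_add (act G G f) h k
    right_distrib := fun f h k => DFunLike.congr_fun (map_add (act G G) f h) k
    zero_mul := fun f => DFunLike.congr_fun (map_zero (act G G)) f
    mul_zero := fun f => map_zero (act G G f)
    mul_assoc := fun f h k => act_act f h k
    one := open Classical in lp.single 1 1 1
    one_mul := fun f => by classical exact single_one_act f
    mul_one := fun f => by classical exact act_single_one f
    norm_mul_le := fun f h => by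
      refine ((act G G).le_opNorm₂ f h).trans ?_
      have := mul_le_mul_of_nonneg_right (norm_act_le G G) (mul_nonneg (norm_nonneg f) (norm_nonneg h))
      linarith }

theorem mul_def {G : Type*} [Group G] (f h : l1 G) : f * h = act G G f h := rfl

theorem mul_apply {G : Type*} [Group G] (f h : l1 G) (x : G) :
    (f * h) x = ∑' g, f g * h (g⁻¹ * x) := act_apply f h x

noncomputable instance instNormedAlgebra (G : Type*) [Group G] : NormedAlgebra ℂ (l1 G) :=
  { Algebra.ofModule
      (fun c f h => DFunLike.congr_fun (map_smul (act G G) c f) h)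
      (fun c f h => map_smul (act G G f) c h) with
    norm_smul_le := fun c f => norm_smul_le c f }

/-- The augmentation character `ε` of `ℓ¹(G)`, with `ε(f) = ∑ g, f(g)`. -/
noncomputable def augmentation (G : Type*) [Group G] : l1 G →L[ℂ] ℂ :=
  lift (fun _ => (1 : ℂ)) 1 (fun _ => by simp)

theorem augmentation_apply {G : Type*} [Group G] (f : l1 G) : augmentation G f = ∑' g, f g := by
  simp [augmentation, lift_apply]

theorem norm_augmentation_le (G : Type*) [Group G] : ‖augmentation G‖ ≤ 1 :=
  norm_lift_le _ zero_le_one _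

theorem augmentation_mul {G : Type*} [Group G] (f h : l1 G) :
    augmentation G (f * h) = augmentation G f * augmentation G h := by
  classical
  have key : ((ContinuousLinearMap.compL ℂ (l1 G) (l1 G) ℂ) (augmentation G)) ∘L (act G G) =
      ((ContinuousLinearMap.lsmul ℂ ℂ).flip (augmentation G)) ∘L (augmentation G) := by
    refine lp.ext_continuousLinearMap ENNReal.one_ne_top fun g => ?_
    ext1
    refine lp.ext_continuousLinearMap ENNReal.one_ne_top fun g' => ?_
    ext1
    simp [lp.singleContinuousLinearMap_apply, act_single, augmentation, lift_single]
  exact congrArg (fun T => T f h) key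

/-- The one-dimensional `ℓ¹(G)`-bimodule `ℂ` with the augmentation action on both sides. -/
noncomputable def trivialBimodule (G : Type*) [Group G] : BanachBimodule (l1 G) ℂ :=
  BanachBimodule.ofCharacter (augmentation G) augmentation_mul

/-- `ℓ¹(S)` as a Banach `ℓ¹(G)`-bimodule: the left action comes from the action of `G` on `S`, and
the right action is the augmentation action `x · f = ε(f) x`. -/
noncomputable def actionBimodule (G S : Type*) [Group G] [MulAction G S] :
    BanachBimodule (l1 G) (l1 S) where
  left := act G S
  right := (ContinuousLinearMap.lsmul ℂ ℂ) ∘L augmentation G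
  left_mul := act_act
  right_mul f h φ := by simp [augmentation_mul, smul_smul]
  left_right f h φ := by simp

/-- The complexes `C^*(ℓ¹(G), ℂ)` have coboundary operators bounded independently of `G`. -/
theorem norm_d_trivialBimodule_le (G : Type*) [Group G] (n : ℕ) :
    ‖(Hochschild.complex (trivialBimodule G)).d n‖ ≤ n + 2 := by
  have h : ‖(ContinuousLinearMap.mul ℂ ℂ) ∘L augmentation G‖ ≤ 1 := by
    refine ContinuousLinearMap.opNorm_le_bound _ zero_le_one fun f => ?_
    rw [ContinuousLinearMap.comp_apply, ContinuousLinearMap.opNorm_mul_apply]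
    exact ((augmentation G).le_opNorm f).trans
      (mul_le_mul_of_nonneg_right (norm_augmentation_le G) (norm_nonneg f))
  refine (Hochschild.norm_d_le (trivialBimodule G) n).trans ?_
  have h1 : ‖(trivialBimodule G).left‖ ≤ 1 := h
  have h2 : ‖(trivialBimodule G).right‖ ≤ 1 := h
  linarith

/-- The complex `0 → ⨁^∞ C^0(ℓ¹(H_x), ℂ) → ⨁^∞ C^1(ℓ¹(H_x), ℂ) → ⋯`, the `ℓ^∞`-sums being over
`x ∈ I`, where `H_x` is the stabilizer of `x`. -/
noncomputable def stabilizerComplex (G : Type*) {S : Type*} [Group G] [MulAction G S] (I : Set S) :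
    BanachCochainComplex (fun n => lp (fun x : I =>
      Hochschild.Cochain (l1 (MulAction.stabilizer G (x : S))) ℂ n) ∞) :=
  BanachCochainComplex.linftySum
    (fun x : I => Hochschild.complex (trivialBimodule (MulAction.stabilizer G (x : S))))
    (fun n => ⟨n + 2, fun _ => norm_d_trivialBimodule_le _ n⟩)

end l1

/-!
An `n`-cochain on `ℓ¹(G)` with coefficients in `ℓ¹(S)'` is a bounded function on `Gⁿ × S`, and the
pair `(g, s)` is a string of `n` composable arrows, starting at `s`, in the action groupoid of `G`
on `S` (`IsBoundedFunctions`, `l1.isBoundedFunctions_evalAction`). In the same way, a bounded family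
of cochains on the algebras `ℓ¹(Hₓ)` is a bounded function on strings in the disjoint union of the
groups `Hₓ`. Under these identifications the Hochschild coboundaries become the coboundaries of
bounded groupoid cohomology.

The inclusion of `⨿ₓ Hₓ` in the action groupoid is an equivalence: a choice, for each `s`, of an
element `t s` that carries the representative of its orbit to `s`, with `t = 1` on
representatives, gives a retraction (`retract`), and `t` is a natural isomorphism from the composite
endofunctor of the action groupoid to the identity. The associated prism operator is a homotopy,
bounded in each degree, between the identity and the pullback along that endofunctor. Hence
restriction to the stabilizers is a homotopy equivalence through bounded operators, and so a linear
homeomorphism on cohomology (`BanachCochainComplex.nonempty_cohomology_equiv`).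

The homotopy formula is proved in homogeneous coordinates, where a string of arrows is given by
vertices `vᵢ ∈ G` with quotients `gᵢ = vᵢ⁻¹ vᵢ₊₁`. There the coboundary omits vertices and both it
and the prism operator obey a recursion in the first vertex, which makes the formula an induction on
the degree (`simplicialCoboundary_prism_add`).
-/

/-! ### Homotopy equivalences and topological cohomology -/

namespace BanachCochainComplex

section

variable {X Y : ℕ → Type*} [∀ n, NormedAddCommGroup (X n)]
  [∀ n, NormedSpace ℂ (X n)] [∀ n, CompleteSpace (X n)] [∀ n, NormedAddCommGroup (Y n)]
  [∀ n, NormedSpace ℂ (Y n)] [∀ n, CompleteSpace (Y n)]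

/-- The map on cohomology in degree `n` induced by a bounded linear map which carries cocycles to
cocycles and coboundaries to coboundaries. -/
noncomputable def cohomologyMap (K : BanachCochainComplex X) (L : BanachCochainComplex Y) {n : ℕ}
    (f : X n →L[ℂ] Y n) (hz : ∀ x ∈ K.cocycles n, f x ∈ L.cocycles n)
    (hb : ∀ x ∈ K.coboundaries n, f x ∈ L.coboundaries n) :
    K.Cohomology n →L[ℂ] L.Cohomology n where
  toLinearMap := Submodule.mapQ _ _ (f.toLinearMap.restrict hz) fun x hx => hb x hx
  cont := by
    refine continuous_quot_lift _ ?_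
    refine continuous_quot_mk.comp ?_
    exact (f.continuous.comp continuous_subtype_val).subtype_mk _

/-- Bounded cochain maps in both directions, one composite being the identity and the other
homotopic to it through bounded operators, identify the cohomology spaces topologically. The
section `F` is not assumed to be a cochain map, since this follows: `F ∘ ι` commutes with the
coboundary because it is homotopic to the identity, and `ι` is onto. -/
theorem nonempty_cohomology_equiv (K : BanachCochainComplex X) (L : BanachCochainComplex Y)
    (ι : ∀ n, X n →L[ℂ] Y n) (F : ∀ n, Y n →L[ℂ] X n) (H : ∀ n, X (n + 1) →L[ℂ] X n)
    (hι : ∀ n x, ι (n + 1) (K.d n x) = L.d n (ι n x)) (hιF : ∀ n y, ι n (F n y) = y)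
    (h_zero : ∀ x, F 0 (ι 0 x) - x = H 0 (K.d 0 x))
    (h_succ : ∀ n x, F (n + 1) (ι (n + 1) x) - x = H (n + 1) (K.d (n + 1) x) + K.d n (H n x))
    (n : ℕ) : Nonempty (K.Cohomology n ≃L[ℂ] L.Cohomology n) := by
  have hcomm : ∀ n x, F (n + 1) (ι (n + 1) (K.d n x)) = K.d n (F n (ι n x)) := by
    intro n x
    have h1 := h_succ n (K.d n x)
    rw [K.d_d, map_zero, zero_add, sub_eq_iff_eq_add] at h1
    have h2 : K.d n (F n (ι n x) - x) = K.d n (H n (K.d n x)) := by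
      cases n with
      | zero => rw [h_zero]
      | succ n => rw [h_succ, map_add, K.d_d, add_zero]
    rw [h1, ← h2, map_sub, sub_add_cancel]
  have hF : ∀ n y, F (n + 1) (L.d n y) = K.d n (F n y) := by
    intro n y
    have := hcomm n (F n y)
    rwa [hι, hιF] at this
  have ιz : ∀ n, ∀ x ∈ K.cocycles n, ι n x ∈ L.cocycles n := by
    intro n x hx
    have hx' : K.d n x = 0 := hx
    change L.d n (ι n x) = 0
    rw [← hι, hx', map_zero]
  have Fz : ∀ n, ∀ y ∈ L.cocycles n, F n y ∈ K.cocycles n := by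
    intro n y hy
    have hy' : L.d n y = 0 := hy
    change K.d n (F n y) = 0
    rw [← hF, hy', map_zero]
  have ιb : ∀ n, ∀ x ∈ K.coboundaries n, ι n x ∈ L.coboundaries n := by
    rintro (_ | n) x hx
    · rw [(Submodule.mem_bot ℂ).1 hx, map_zero]
      exact zero_mem _
    · obtain ⟨z, rfl⟩ := hx
      exact ⟨ι n z, (hι n z).symm⟩
  have Fb : ∀ n, ∀ y ∈ L.coboundaries n, F n y ∈ K.coboundaries n := by
    rintro (_ | n) y hy
    · rw [(Submodule.mem_bot ℂ).1 hy, map_zero]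
      exact zero_mem _
    · obtain ⟨z, rfl⟩ := hy
      exact ⟨F n z, (hF n z).symm⟩
  have hhom : ∀ n, ∀ x ∈ K.cocycles n, F n (ι n x) - x ∈ K.coboundaries n := by
    rintro (_ | n) x hx
    · have hx' : K.d 0 x = 0 := hx
      rw [h_zero, hx', map_zero]
      exact zero_mem _
    · have hx' : K.d (n + 1) x = 0 := hx
      rw [h_succ, hx', map_zero, zero_add]
      exact ⟨H n x, rfl⟩
  refine ⟨ContinuousLinearEquiv.equivOfInverse (cohomologyMap K L (ι n) (ιz n) (ιb n))
    (cohomologyMap L K (F n) (Fz n) (Fb n)) ?_ ?_⟩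
  · intro q
    obtain ⟨x, rfl⟩ := Submodule.Quotient.mk_surjective _ q
    exact (Submodule.Quotient.eq _).2 (hhom n x x.2)
  · intro q
    obtain ⟨y, rfl⟩ := Submodule.Quotient.mk_surjective _ q
    exact congrArg Submodule.Quotient.mk (Subtype.ext (hιF n y))

end

end BanachCochainComplex

/-! ### The prism operator on simplicial cochains -/

section Simplicial

variable {V W : Type*}

/-- The coboundary of a function of `n` vertices, `(δf)(v₀, …, vₙ) = ∑ᵢ (-1)ⁱ f(v₀, …, v̂ᵢ, …, vₙ)`.
For `n = 0` this is the augmentation. -/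
def simplicialCoboundary {n : ℕ} (f : (Fin n → V) → ℂ) (v : Fin (n + 1) → V) : ℂ :=
  ∑ i : Fin (n + 1), (-1) ^ (i : ℕ) * f (i.removeNth v)

theorem simplicialCoboundary_eq_sub {n : ℕ} (f : (Fin (n + 1) → V) → ℂ) (v : Fin (n + 2) → V) :
    simplicialCoboundary f v = f (Fin.tail v) -
      simplicialCoboundary (fun w => f (Fin.cons (v 0) w)) (Fin.tail v) := by
  rw [simplicialCoboundary, Fin.sum_univ_succ, simplicialCoboundary, sub_eq_add_neg,
    ← Finset.sum_neg_distrib]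
  congr 1
  · simp [Fin.removeNth_zero]
  · refine Finset.sum_congr rfl fun i _ => ?_
    have : i.succ.removeNth v = Fin.cons (v 0) (i.removeNth (Fin.tail v)) := by
      ext k
      refine Fin.cases ?_ (fun k => ?_) k <;> simp [Fin.removeNth, Fin.tail]
    rw [this, Fin.val_succ, pow_succ]
    ring

theorem simplicialCoboundary_sub {n : ℕ} (f g : (Fin n → V) → ℂ) (v : Fin (n + 1) → V) :
    simplicialCoboundary (fun w => f w - g w) v =
      simplicialCoboundary f v - simplicialCoboundary g v := by
  simp [simplicialCoboundary, mul_sub]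

/-- The prism operator of a self-map `u` of the set of vertices,
`(hf)(v₀, …, vₙ₋₁) = ∑ⱼ (-1)ʲ f(v₀, …, vⱼ, u vⱼ, …, u vₙ₋₁)`, by recursion on the first vertex. -/
def prism (u : V → V) : ∀ {n : ℕ}, ((Fin (n + 1) → V) → ℂ) → (Fin n → V) → ℂ
  | 0, _, _ => 0
  | _ + 1, f, v => f (Fin.cons (v 0) (u ∘ v)) -
      prism u (fun w => f (Fin.cons (v 0) w)) (Fin.tail v)

theorem prism_sub (u : V → V) {n : ℕ} (f g : (Fin (n + 1) → V) → ℂ) (v : Fin n → V) :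
    prism u (fun w => f w - g w) v = prism u f v - prism u g v := by
  induction n with
  | zero => simp [prism]
  | succ n ih => simp only [prism, ih]; ring

theorem prism_add (u : V → V) {n : ℕ} (f g : (Fin (n + 1) → V) → ℂ) (v : Fin n → V) :
    prism u (fun w => f w + g w) v = prism u f v + prism u g v := by
  induction n with
  | zero => simp [prism]
  | succ n ih => simp only [prism, ih]; ring

theorem prism_const_mul (u : V → V) {n : ℕ} (c : ℂ) (f : (Fin (n + 1) → V) → ℂ) (v : Fin n → V) :
    prism u (fun w => c * f w) v = c * prism u f v := by
  induction n with
  | zero => simp [prism]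
  | succ n ih => simp only [prism, ih]; ring

theorem norm_prism_le (u : V → V) {n : ℕ} (f : (Fin (n + 1) → V) → ℂ) {C : ℝ}
    (hf : ∀ w, ‖f w‖ ≤ C) (v : Fin n → V) : ‖prism u f v‖ ≤ n * C := by
  induction n with
  | zero => simp [prism]
  | succ n ih =>
    refine (norm_sub_le _ _).trans ((add_le_add (hf _) (ih _ (fun w => hf _) _)).trans_eq ?_)
    push_cast
    ring

theorem prism_comp (F : V → W) (u : V → V) (u' : W → W) (hF : ∀ v, F (u v) = u' (F v)) {n : ℕ}
    (f : (Fin (n + 1) → W) → ℂ) (v : Fin n → V) :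
    prism u (fun w => f (F ∘ w)) v = prism u' f (F ∘ v) := by
  have hcons : ∀ {m : ℕ} (a : V) (w : Fin m → V),
      F ∘ (Fin.cons a w : Fin (m + 1) → V) = Fin.cons (F a) (F ∘ w) := by
    intro m a w
    ext k
    refine Fin.cases ?_ (fun k => ?_) k <;> simp
  induction n with
  | zero => simp [prism]
  | succ n ih =>
    simp only [prism, hcons]
    rw [ih (fun w => f (Fin.cons (F (v 0)) w))]
    congr 2
    congr 1
    ext k
    simp [hF]

/-- The prism operator is a homotopy from the identity to pullback along `u`. By linearity in `f`
the proof is an induction that freezes the first vertex. -/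
theorem simplicialCoboundary_prism_add (u : V → V) {n : ℕ} (f : (Fin (n + 1) → V) → ℂ)
    (v : Fin (n + 1) → V) :
    simplicialCoboundary (prism u f) v + prism u (simplicialCoboundary f) v =
      f (u ∘ v) - f v := by
  induction n with
  | zero =>
    have h1 : ∀ w w' : Fin 1 → V, w 0 = w' 0 → f w = f w' := fun w w' h => by
      congr 1
      ext i
      rwa [Subsingleton.elim i 0]
    have h2 : simplicialCoboundary (prism u f) v = 0 := by simp [simplicialCoboundary, prism]
    have h3 : f ((0 : Fin 2).removeNth (Fin.cons (v 0) (u ∘ v) : Fin 2 → V)) = f (u ∘ v) :=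
      h1 _ _ rfl
    have h4 : f ((1 : Fin 2).removeNth (Fin.cons (v 0) (u ∘ v) : Fin 2 → V)) = f v :=
      h1 _ _ rfl
    rw [h2, zero_add, prism, prism, sub_zero, simplicialCoboundary, Fin.sum_univ_two, h3, h4]
    simp [sub_eq_add_neg]
  | succ n ih =>
    have key := ih (fun w => f (Fin.cons (v 0) w)) (Fin.tail v)
    have e1 : simplicialCoboundary (prism u f) v = prism u f (Fin.tail v) -
        (simplicialCoboundary (fun w => f (Fin.cons (v 0) (Fin.cons (u (v 0)) (u ∘ w))))
            (Fin.tail v) -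
          simplicialCoboundary (prism u fun w => f (Fin.cons (v 0) w)) (Fin.tail v)) := by
      rw [simplicialCoboundary_eq_sub, ← simplicialCoboundary_sub]
      congr 3
      ext w
      simp only [prism, Fin.cons_zero, Fin.tail_cons]
      congr 2
      ext k
      refine Fin.cases ?_ (fun k => Fin.cases ?_ (fun k => ?_) k) k <;> simp
    have e2 : prism u (simplicialCoboundary f) v = f (u ∘ v) -
        (f (Fin.cons (v 0) (u ∘ Fin.tail v)) -
          simplicialCoboundary (fun w => f (Fin.cons (v 0) (Fin.cons (u (v 0)) (u ∘ w))))
            (Fin.tail v)) -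
        (prism u f (Fin.tail v) -
          prism u (simplicialCoboundary fun w => f (Fin.cons (v 0) w)) (Fin.tail v)) := by
      rw [prism, ← prism_sub, simplicialCoboundary_eq_sub, Fin.tail_cons, Fin.cons_zero,
        simplicialCoboundary_eq_sub]
      congr 2
      ext w
      rw [simplicialCoboundary_eq_sub, Fin.tail_cons, Fin.cons_zero]
    have e3 : (Fin.cons (v 0) (Fin.tail v) : Fin (n + 2) → V) = v := Fin.cons_self_tail v
    rw [e3] at key
    rw [e1, e2]
    linear_combination key

end Simplicial

/-! ### Spaces of bounded functions -/

section BoundedFunctions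

/-- The evaluation map `val` identifies the Banach space `X` isometrically with the bounded
functions on `Ω`, under the supremum norm. -/
structure IsBoundedFunctions {X Ω : Type*} [NormedAddCommGroup X] [NormedSpace ℂ X]
    (val : X →ₗ[ℂ] Ω → ℂ) : Prop where
  injective : Function.Injective val
  norm_le : ∀ x ω, ‖val x ω‖ ≤ ‖x‖
  exists_eq : ∀ (v : Ω → ℂ) (C : ℝ), 0 ≤ C → (∀ ω, ‖v ω‖ ≤ C) → ∃ x, ‖x‖ ≤ C ∧ val x = v

/-- A linear operation on functions that multiplies sup-norm bounds by at most `k` defines a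
bounded operator between the spaces of bounded functions. -/
theorem IsBoundedFunctions.exists_operator {X Y Ω Ω' : Type*} [NormedAddCommGroup X]
    [NormedSpace ℂ X] [NormedAddCommGroup Y] [NormedSpace ℂ Y] {valX : X →ₗ[ℂ] Ω → ℂ}
    {valY : Y →ₗ[ℂ] Ω' → ℂ} (hX : IsBoundedFunctions valX) (hY : IsBoundedFunctions valY)
    (T : (Ω → ℂ) →ₗ[ℂ] (Ω' → ℂ)) (k : ℝ) (hk : 0 ≤ k)
    (hT : ∀ (v : Ω → ℂ) (C : ℝ), 0 ≤ C → (∀ ω, ‖v ω‖ ≤ C) → ∀ ω', ‖T v ω'‖ ≤ k * C) :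
    ∃ U : X →L[ℂ] Y, ∀ x, valY (U x) = T (valX x) := by
  have h : ∀ x, ∃ y, ‖y‖ ≤ k * ‖x‖ ∧ valY y = T (valX x) := fun x =>
    hY.exists_eq _ _ (by positivity) (hT _ _ (norm_nonneg x) (hX.norm_le x))
  choose U hU hval using h
  exact ⟨LinearMap.mkContinuous
    { toFun := U
      map_add' := fun x y => hY.injective (by simp [hval])
      map_smul' := fun c x => hY.injective (by simp [hval]) } k hU, hval⟩

end BoundedFunctions

/-! ### Cochains on `ℓ¹` as bounded functions -/

namespace l1

open Classical in
/-- The point mass at `x`, as an element of `ℓ¹(X)`. -/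
noncomputable def delta {X : Type*} (x : X) : l1 X := lp.single 1 x 1

theorem norm_delta {X : Type*} (x : X) : ‖delta x‖ = 1 := by
  classical
  rw [delta, lp.norm_single (by simp)]
  simp

theorem ext_delta {X E : Type*} [NormedAddCommGroup E] [NormedSpace ℂ E] {S T : l1 X →L[ℂ] E}
    (h : ∀ x, S (delta x) = T (delta x)) : S = T := by
  classical
  refine lp.ext_continuousLinearMap ENNReal.one_ne_top fun x => ?_
  ext1
  convert h x <;> simp [delta, lp.singleContinuousLinearMap_apply]

theorem lift_delta {X E : Type*} [NormedAddCommGroup E] [NormedSpace ℂ E]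
    [CompleteSpace E] (v : X → E) (C : ℝ) (hv : ∀ x, ‖v x‖ ≤ C) (x : X) :
    lift v C hv (delta x) = v x := by
  classical
  rw [delta, lift_single, one_smul]

theorem act_delta {G S : Type*} [Group G] [MulAction G S] (g : G) (s : S) :
    act G S (delta g) (delta s) = delta (g • s) := by
  classical
  rw [delta, delta, act_single, one_mul, delta]

theorem delta_mul_delta {G : Type*} [Group G] (g h : G) :
    delta g * delta h = delta (g * h) := act_delta g h

theorem augmentation_delta {G : Type*} [Group G] (g : G) : augmentation G (delta g) = 1 :=
  lift_delta _ _ _ _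

theorem contractNth_delta {G : Type*} [Group G] {n : ℕ} (j : Fin (n + 1)) (g : Fin (n + 1) → G) :
    j.contractNth (· * ·) (fun i => delta (g i)) =
      fun i => delta (j.contractNth (· * ·) g i) := by
  ext1 k
  simp only [Fin.contractNth]
  split_ifs <;> simp [delta_mul_delta]

/-- A bounded multilinear map on `ℓ¹(X)` is determined by its values on point masses. -/
theorem multilinear_ext {X E : Type*} [NormedAddCommGroup E] [NormedSpace ℂ E] {n : ℕ}
    {S T : ContinuousMultilinearMap ℂ (fun _ : Fin n => l1 X) E}
    (h : ∀ x : Fin n → X, S (fun i => delta (x i)) = T (fun i => delta (x i))) : S = T := by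
  induction n with
  | zero =>
    ext a
    rw [Subsingleton.elim a fun i => delta (i.elim0 : X)]
    exact h _
  | succ n ih =>
    have : S.curryLeft = T.curryLeft := by
      refine ext_delta fun x => ih fun y => ?_
      have := h (Fin.cons x y)
      have e : (fun i => delta ((Fin.cons x y : Fin (n + 1) → X) i)) =
          Fin.cons (delta x) fun i => delta (y i) := by
        ext1 k
        refine Fin.cases ?_ (fun k => ?_) k <;> simp
      rwa [e] at this
    rw [← S.uncurry_curryLeft, this, T.uncurry_curryLeft]

/-- Every bounded function on `Xⁿ` extends to a bounded multilinear map on `ℓ¹(X)` with the same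
bound. -/
theorem exists_multilinear {X E : Type*} [NormedAddCommGroup E] [NormedSpace ℂ E]
    [CompleteSpace E] {n : ℕ} (v : (Fin n → X) → E) (C : ℝ) (hC : 0 ≤ C) (hv : ∀ x, ‖v x‖ ≤ C) :
    ∃ T : ContinuousMultilinearMap ℂ (fun _ : Fin n => l1 X) E, ‖T‖ ≤ C ∧
      ∀ x, T (fun i => delta (x i)) = v x := by
  induction n with
  | zero =>
    refine ⟨ContinuousMultilinearMap.constOfIsEmpty ℂ _ (v Fin.elim0), ?_, fun x => ?_⟩
    · rw [ContinuousMultilinearMap.norm_constOfIsEmpty]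
      exact hv _
    · rw [Subsingleton.elim x Fin.elim0]
      rfl
  | succ n ih =>
    choose T hT hTv using fun x : X => ih (fun y => v (Fin.cons x y)) (fun y => hv _)
    refine ⟨(lift T C hT).uncurryLeft, ?_, fun x => ?_⟩
    · rw [ContinuousLinearMap.uncurryLeft_norm]
      exact norm_lift_le T hC hT
    · rw [ContinuousLinearMap.uncurryLeft_apply, lift_delta]
      exact (hTv _ _).trans (congrArg v (Fin.cons_self_tail x))

/-- The values on point masses of a cochain on `ℓ¹(G)` with coefficients in `ℓ¹(S)'`. -/
noncomputable def evalAction (G S : Type*) [Group G] (n : ℕ) :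
    Hochschild.Cochain (l1 G) (l1 S →L[ℂ] ℂ) n →ₗ[ℂ] (Fin n → G) × S → ℂ where
  toFun ψ p := ψ (fun i => delta (p.1 i)) (delta p.2)
  map_add' _ _ := rfl
  map_smul' _ _ := rfl

theorem norm_prod_delta {X : Type*} {n : ℕ} (x : Fin n → X) : ∏ i, ‖delta (x i)‖ = 1 := by
  simp [norm_delta]

theorem isBoundedFunctions_evalAction (G S : Type*) [Group G] (n : ℕ) :
    IsBoundedFunctions (evalAction G S n) where
  injective ψ ψ' h := multilinear_ext fun g => ext_delta fun s => congrFun h (g, s)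
  norm_le ψ p := by
    have h := ((ψ fun i => delta (p.1 i)).le_opNorm (delta p.2)).trans
      (mul_le_mul_of_nonneg_right (ψ.le_opNorm _) (norm_nonneg _))
    rwa [norm_delta, norm_prod_delta, mul_one, mul_one] at h
  exists_eq v C hC hv := by
    obtain ⟨T, hT, hTv⟩ := exists_multilinear
      (fun g : Fin n → G => lift (fun s : S => v (g, s)) C fun s => hv _) C hC
      fun g => norm_lift_le _ hC _
    refine ⟨T, hT, funext fun p => ?_⟩
    exact (congrArg (fun F => F (delta p.2)) (hTv p.1)).trans (lift_delta _ _ _ _)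

/-- The values on point masses of a bounded family of cochains on `ℓ¹(H x)` with coefficients in
`ℂ`. -/
noncomputable def evalFamily {ι : Type*} (H : ι → Type*) [∀ x, Group (H x)] (n : ℕ) :
    lp (fun x => Hochschild.Cochain (l1 (H x)) ℂ n) ∞ →ₗ[ℂ] (Σ x, (Fin n → H x)) → ℂ where
  toFun φ p := φ p.1 fun i => delta (p.2 i)
  map_add' _ _ := rfl
  map_smul' _ _ := rfl

theorem isBoundedFunctions_evalFamily {ι : Type*} (H : ι → Type*) [∀ x, Group (H x)] (n : ℕ) :
    IsBoundedFunctions (evalFamily H n) where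
  injective φ φ' h := by
    ext1
    ext1 x
    exact multilinear_ext fun g => congrFun h ⟨x, g⟩
  norm_le φ p := by
    have h := ((φ p.1).le_opNorm fun i => delta (p.2 i)).trans
      (mul_le_mul_of_nonneg_right (lp.norm_apply_le_norm ENNReal.top_ne_zero φ p.1)
        (Finset.prod_nonneg fun _ _ => norm_nonneg _))
    rwa [norm_prod_delta, mul_one] at h
  exists_eq v C hC hv := by
    choose T hT hTv using fun x => exists_multilinear
      (fun g : Fin n → H x => v ⟨x, g⟩) C hC fun g => hv _
    exact ⟨⟨T, memℓp_infty ⟨C, by rintro _ ⟨x, rfl⟩; exact hT x⟩⟩,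
      lp.norm_le_of_forall_le hC hT, funext fun p => hTv p.1 p.2⟩

theorem evalAction_d {G S : Type*} [Group G] [MulAction G S] {n : ℕ}
    (ψ : Hochschild.Cochain (l1 G) (l1 S →L[ℂ] ℂ) n) (g : Fin (n + 1) → G) (s : S) :
    evalAction G S (n + 1) ((Hochschild.complex (actionBimodule G S).dual).d n ψ) (g, s) =
      evalAction G S n ψ (Fin.tail g, s) +
      ∑ j : Fin n, (-1) ^ ((j : ℕ) + 1) *
        evalAction G S n ψ (j.castSucc.contractNth (· * ·) g, s) +
      (-1) ^ (n + 1) * evalAction G S n ψ (Fin.init g, g (Fin.last n) • s) := by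
  change Hochschild.d (actionBimodule G S).dual n ψ (fun i => delta (g i)) (delta s) = _
  rw [Hochschild.d_apply]
  simp only [add_apply, sum_apply,
    smul_apply, smul_eq_mul, BanachBimodule.dual_left_apply,
    BanachBimodule.dual_right_apply, contractNth_delta]
  have hl : (actionBimodule G S).left (delta (g (Fin.last n))) (delta s) =
      delta (g (Fin.last n) • s) := act_delta _ _
  have hr : (actionBimodule G S).right (delta (g 0)) (delta s) = delta s := by
    simp [actionBimodule, augmentation_delta]
  rw [hl, hr]
  rfl

theorem evalFamily_d {G S : Type*} [Group G] [MulAction G S] {I : Set S} {n : ℕ}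
    (φ : lp (fun x : I => Hochschild.Cochain (l1 (MulAction.stabilizer G (x : S))) ℂ n) ∞)
    (x : I) (h : Fin (n + 1) → MulAction.stabilizer G (x : S)) :
    evalFamily (fun x : I => MulAction.stabilizer G (x : S)) (n + 1)
        ((stabilizerComplex G I).d n φ) ⟨x, h⟩ =
      evalFamily (fun x : I => MulAction.stabilizer G (x : S)) n φ ⟨x, Fin.tail h⟩ +
      ∑ j : Fin n, (-1) ^ ((j : ℕ) + 1) *
        evalFamily (fun x : I => MulAction.stabilizer G (x : S)) n φ
          ⟨x, j.castSucc.contractNth (· * ·) h⟩ +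
      (-1) ^ (n + 1) *
        evalFamily (fun x : I => MulAction.stabilizer G (x : S)) n φ ⟨x, Fin.init h⟩ := by
  change Hochschild.d (trivialBimodule _) n (φ x) _ = _
  rw [Hochschild.d_apply]
  simp only [contractNth_delta, trivialBimodule, BanachBimodule.ofCharacter_left_apply,
    BanachBimodule.ofCharacter_right_apply, augmentation_delta, one_mul, smul_eq_mul]
  rfl

end l1

/-! ### Cochains of the action groupoid -/

section ActionGroupoid

variable {G S : Type*} [Group G] [MulAction G S]

/-- A cochain of the action groupoid in homogeneous coordinates: the vertices `v₀, …, vₙ` of `G`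
stand for the string of arrows `vᵢ⁻¹ vᵢ₊₁`, which starts at the point `vₙ⁻¹ • s` and whose last entry
acts first; the vertex `vᵢ` lies over the point `vᵢ⁻¹ • s`. -/
def homogeneous {n : ℕ} (ψ : (Fin n → G) × S → ℂ) (s : S) (v : Fin (n + 1) → G) : ℂ :=
  ψ (fun i => (v i.castSucc)⁻¹ * v i.succ, (v (Fin.last n))⁻¹ • s)

/-- The Hochschild coboundary, in terms of values on point masses, for coefficients in `ℓ¹(S)'`. -/
def actionCoboundary {n : ℕ} (ψ : (Fin n → G) × S → ℂ) (p : (Fin (n + 1) → G) × S) : ℂ :=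
  ψ (Fin.tail p.1, p.2) +
    ∑ j : Fin n, (-1) ^ ((j : ℕ) + 1) * ψ (j.castSucc.contractNth (· * ·) p.1, p.2) +
    (-1) ^ (n + 1) * ψ (Fin.init p.1, p.1 (Fin.last n) • p.2)

theorem contractNth_inv_mul {n : ℕ} (j : Fin n) (v : Fin (n + 2) → G) (k : Fin n) :
    j.castSucc.contractNth (· * ·) (fun i => (v i.castSucc)⁻¹ * v i.succ) k =
      (v (j.castSucc.succ.succAbove k.castSucc))⁻¹ * v (j.castSucc.succ.succAbove k.succ) := by
  rcases lt_trichotomy (k : ℕ) j with h | h | h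
  · rw [Fin.contractNth_apply_of_lt _ _ _ _ h, Fin.succAbove_of_castSucc_lt,
      Fin.succAbove_of_castSucc_lt]
    · rfl
    all_goals simp only [Fin.lt_def, Fin.val_succ, Fin.val_castSucc]; omega
  · rw [Fin.contractNth_apply_of_eq _ _ _ _ h, Fin.succAbove_of_castSucc_lt,
      Fin.succAbove_of_le_castSucc]
    · have : (k.castSucc.succ : Fin (n + 2)) = k.succ.castSucc := rfl
      simp only [this]
      group
    all_goals simp only [Fin.lt_def, Fin.le_def, Fin.val_succ, Fin.val_castSucc]; omega
  · rw [Fin.contractNth_apply_of_gt _ _ _ _ h, Fin.succAbove_of_le_castSucc,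
      Fin.succAbove_of_le_castSucc]
    · rfl
    all_goals simp only [Fin.le_def, Fin.val_succ, Fin.val_castSucc]; omega

theorem simplicialCoboundary_homogeneous {n : ℕ} (ψ : (Fin n → G) × S → ℂ) (s : S)
    (v : Fin (n + 2) → G) :
    simplicialCoboundary (homogeneous ψ s) v = homogeneous (actionCoboundary ψ) s v := by
  rw [simplicialCoboundary, Fin.sum_univ_succ, Fin.sum_univ_castSucc]
  simp only [homogeneous, actionCoboundary]
  rw [← add_assoc]
  congr 1
  · congr 1
    · simp only [Fin.removeNth_zero, Fin.val_zero, pow_zero, one_mul]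
      rfl
    · refine Finset.sum_congr rfl fun j _ => ?_
      rw [Fin.val_succ, Fin.val_castSucc]
      congr 2
      ext1
      · ext k
        exact (contractNth_inv_mul j v k).symm
      · simp only [Fin.removeNth]
        rw [Fin.succAbove_of_le_castSucc]
        · rfl
        · simp only [Fin.le_def, Fin.val_succ, Fin.val_castSucc, Fin.val_last]; omega
  · rw [Fin.val_succ, Fin.val_last]
    congr 2
    ext1
    · ext k
      simp only [Fin.removeNth, Fin.succ_last, Fin.succAbove_last, Fin.init]
      rfl
    · simp only [Fin.removeNth, Fin.succ_last, Fin.succAbove_last, mul_smul]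
      simp

/-- The string of vertices from `1` with successive quotients `g` recovers inhomogeneous
coordinates. -/
theorem homogeneous_partialProd {n : ℕ} (ψ : (Fin n → G) × S → ℂ) (g : Fin n → G) (s : S) :
    homogeneous ψ (Fin.partialProd g (Fin.last n) • s) (Fin.partialProd g) = ψ (g, s) := by
  simp only [homogeneous, inv_smul_smul]
  congr 2
  ext i
  exact Fin.partialProd_right_inv g i

theorem homogeneous_smul {n : ℕ} (ψ : (Fin n → G) × S → ℂ) (a : G) (s : S)
    (v : Fin (n + 1) → G) : homogeneous ψ (a • s) (a • v) = homogeneous ψ s v := by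
  simp only [homogeneous, Pi.smul_apply, smul_eq_mul, mul_inv_rev, mul_smul, inv_smul_smul]
  simp [mul_assoc]

/-- The map on vertices, in homogeneous coordinates based at `s`, that moves the object `p = v⁻¹ • s`
under the vertex `v` along `t p`, to the object `(t p)⁻¹ • p`. -/
def transport (t : S → G) (s : S) (v : G) : G := v * t (v⁻¹ • s)

theorem smul_transport (t : S → G) (s : S) (a v : G) :
    a * transport t s v = transport t (a • s) (a * v) := by
  simp [transport, mul_smul, mul_assoc]

/-- The prism operator of `transport t`, in inhomogeneous coordinates. -/
def actionPrism (t : S → G) (n : ℕ) :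
    ((Fin (n + 1) → G) × S → ℂ) →ₗ[ℂ] ((Fin n → G) × S → ℂ) where
  toFun ψ p := prism (transport t (Fin.partialProd p.1 (Fin.last n) • p.2))
    (homogeneous ψ (Fin.partialProd p.1 (Fin.last n) • p.2)) (Fin.partialProd p.1)
  map_add' _ _ := funext fun _ => prism_add _ _ _ _
  map_smul' _ _ := funext fun _ => prism_const_mul _ _ _ _

theorem homogeneous_actionPrism (t : S → G) {n : ℕ} (ψ : (Fin (n + 1) → G) × S → ℂ) (s : S)
    (v : Fin (n + 1) → G) :
    homogeneous (actionPrism t n ψ) s v = prism (transport t s) (homogeneous ψ s) v := by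
  have hv : ∀ i, v 0 * Fin.partialProd (fun i : Fin n => (v i.castSucc)⁻¹ * v i.succ) i = v i :=
    congrFun (Fin.partialProd_left_inv v)
  set w := Fin.partialProd fun i : Fin n => (v i.castSucc)⁻¹ * v i.succ with hw
  have hs : v 0 • w (Fin.last n) • (v (Fin.last n))⁻¹ • s = s := by
    rw [smul_smul, hv, smul_inv_smul]
  change prism (transport t (w (Fin.last n) • (v (Fin.last n))⁻¹ • s))
    (homogeneous ψ (w (Fin.last n) • (v (Fin.last n))⁻¹ • s)) w = _
  generalize w (Fin.last n) • (v (Fin.last n))⁻¹ • s = s' at hs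
  subst hs
  have hvw : prism (transport t (v 0 • s')) (homogeneous ψ (v 0 • s')) v =
      prism (transport t (v 0 • s')) (homogeneous ψ (v 0 • s')) ((v 0 * ·) ∘ w) :=
    congrArg _ (funext fun i => (hv i).symm)
  rw [hvw, ← prism_comp (v 0 * ·) (transport t s') _ (smul_transport t s' (v 0))]
  congr 1
  ext u
  exact (homogeneous_smul ψ (v 0) s' u).symm

/-- In degree `0` the prism operator vanishes, so `h (dψ)` is the whole homotopy. -/
theorem actionPrism_actionCoboundary_zero (t : S → G) (ψ : (Fin 0 → G) × S → ℂ)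
    (g : Fin 0 → G) (s : S) :
    actionPrism t 0 (actionCoboundary ψ) (g, s) =
      homogeneous ψ (Fin.partialProd g (Fin.last 0) • s)
        (transport t (Fin.partialProd g (Fin.last 0) • s) ∘ Fin.partialProd g) - ψ (g, s) := by
  have h : simplicialCoboundary
      (prism (transport t (Fin.partialProd g (Fin.last 0) • s))
        (homogeneous ψ (Fin.partialProd g (Fin.last 0) • s))) (Fin.partialProd g) = 0 := by
    simp [simplicialCoboundary, prism]
  have key := simplicialCoboundary_prism_add
    (transport t (Fin.partialProd g (Fin.last 0) • s))
    (homogeneous ψ (Fin.partialProd g (Fin.last 0) • s)) (Fin.partialProd g)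
  rw [h, zero_add, homogeneous_partialProd, funext (simplicialCoboundary_homogeneous ψ _)] at key
  exact key

/-- The prism operator is a homotopy from the identity to pullback along the transport by `t`. -/
theorem actionPrism_add (t : S → G) {n : ℕ} (ψ : (Fin (n + 1) → G) × S → ℂ)
    (g : Fin (n + 1) → G) (s : S) :
    actionPrism t (n + 1) (actionCoboundary ψ) (g, s) + actionCoboundary (actionPrism t n ψ) (g, s) =
      homogeneous ψ (Fin.partialProd g (Fin.last (n + 1)) • s)
        (transport t (Fin.partialProd g (Fin.last (n + 1)) • s) ∘ Fin.partialProd g) -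
      ψ (g, s) := by
  rw [← homogeneous_partialProd (actionPrism t (n + 1) (actionCoboundary ψ)),
    ← homogeneous_partialProd (actionCoboundary (actionPrism t n ψ)),
    ← homogeneous_partialProd ψ g s, homogeneous_actionPrism,
    ← simplicialCoboundary_homogeneous,
    ← funext (simplicialCoboundary_homogeneous ψ _),
    funext (homogeneous_actionPrism t ψ _), add_comm]
  exact simplicialCoboundary_prism_add _ _ _

theorem norm_actionPrism_le (t : S → G) {n : ℕ} (ψ : (Fin (n + 1) → G) × S → ℂ) (C : ℝ)
    (hψ : ∀ p, ‖ψ p‖ ≤ C) (p : (Fin n → G) × S) : ‖actionPrism t n ψ p‖ ≤ (n + 1 : ℕ) * C :=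
  norm_prism_le _ _ (fun _ => hψ _) _

end ActionGroupoid

/-! ### Retraction onto the stabilizers -/

section Representatives

variable {G S : Type*} [Group G] [MulAction G S] {I : Set S}

/-- A choice of the representative `rep s ∈ I` of the orbit of `s`, and of an element `t s` of `G`
that carries it to `s`, with `t = 1` on `I`. -/
theorem exists_rep (hI : ∀ s : S, ∃! x : S, x ∈ I ∧ s ∈ MulAction.orbit G x) :
    ∃ (rep : S → I) (t : S → G), (∀ s, t s • (rep s : S) = s) ∧ (∀ (g : G) s, rep (g • s) = rep s) ∧
      (∀ x : I, rep x = x) ∧ ∀ x : I, t x = 1 := by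
  classical
  choose rep hrep huniq using hI
  have hself : ∀ x ∈ I, rep x = x := fun x hx =>
    (huniq x x ⟨hx, MulAction.mem_orbit_self x⟩).symm
  choose t ht using fun s => (hrep s).2
  refine ⟨fun s => ⟨rep s, (hrep s).1⟩, fun s => if s ∈ I then 1 else t s, fun s => ?_,
    fun g s => Subtype.ext ?_, fun x => Subtype.ext (hself x x.2), fun x => if_pos x.2⟩
  · by_cases hs : s ∈ I
    · simp [hs, hself s hs]
    · simpa [hs] using ht s
  · exact (huniq _ _ ⟨(hrep s).1, MulAction.mem_orbit_of_mem_orbit g (hrep s).2⟩).symm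

theorem transport_inv_mul_mem_stabilizer {rep : S → I} {t : S → G}
    (ht : ∀ s, t s • (rep s : S) = s) (hrep : ∀ (g : G) s, rep (g • s) = rep s) (a : G) (s : S)
    (v w : G) : (transport t (a • s) v)⁻¹ * transport t (a • s) w ∈
      MulAction.stabilizer G (rep s : S) := by
  have h : ∀ v : G, transport t (a • s) v • (rep s : S) = a • s := by
    intro v
    have := ht (v⁻¹ • a • s)
    rw [hrep, hrep] at this
    rw [transport, mul_smul, this, smul_inv_smul]
  rw [MulAction.mem_stabilizer_iff, mul_smul, h, inv_smul_eq_iff, h]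

/-- The retraction of the action groupoid onto the stabilizers: a string `g` of arrows from `s` is
conjugated by `t` to a string of elements of the stabilizer of `rep s`. -/
def retract {rep : S → I} {t : S → G} (ht : ∀ s, t s • (rep s : S) = s)
    (hrep : ∀ (g : G) s, rep (g • s) = rep s) (n : ℕ) (p : (Fin n → G) × S) :
    Σ x : I, Fin n → MulAction.stabilizer G (x : S) :=
  ⟨rep p.2, fun i => ⟨_, transport_inv_mul_mem_stabilizer ht hrep
    (Fin.partialProd p.1 (Fin.last n)) p.2
    (Fin.partialProd p.1 i.castSucc) (Fin.partialProd p.1 i.succ)⟩⟩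

/-- The inclusion of the stabilizers into the action groupoid. -/
def stabilizerIncl (G : Type*) {S : Type*} [Group G] [MulAction G S] (I : Set S) (n : ℕ)
    (q : Σ x : I, Fin n → MulAction.stabilizer G (x : S)) : (Fin n → G) × S :=
  (fun i => q.2 i, q.1)

theorem sigma_stabilizer_ext {n : ℕ} {q q' : Σ x : I, Fin n → MulAction.stabilizer G (x : S)}
    (h1 : q.1 = q'.1) (h2 : ∀ i, (q.2 i : G) = q'.2 i) : q = q' := by
  obtain ⟨x, h⟩ := q
  obtain ⟨x', h'⟩ := q'
  obtain rfl : x = x' := h1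
  congr 1
  exact funext fun i => Subtype.ext (h2 i)

theorem retract_stabilizerIncl {rep : S → I} {t : S → G} (ht : ∀ s, t s • (rep s : S) = s)
    (hrep : ∀ (g : G) s, rep (g • s) = rep s) (hself : ∀ x : I, rep x = x) (hone : ∀ x : I, t x = 1)
    (n : ℕ) (q : Σ x : I, Fin n → MulAction.stabilizer G (x : S)) :
    retract ht hrep n (stabilizerIncl G I n q) = q := by
  refine sigma_stabilizer_ext (hself q.1) fun i => ?_
  have hmem : ∀ i, Fin.partialProd (fun i => (q.2 i : G)) i ∈
      MulAction.stabilizer G (q.1 : S) := by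
    intro i
    induction i using Fin.induction with
    | zero => rw [Fin.partialProd_zero]; exact one_mem _
    | succ i ih => rw [Fin.partialProd_succ]; exact mul_mem ih (q.2 i).2
  -- All vertices lie over the representative `q.1`, where `t = 1`.
  have htr : ∀ i, transport t (Fin.partialProd (fun i => (q.2 i : G)) (Fin.last n) • (q.1 : S))
      (Fin.partialProd (fun i => (q.2 i : G)) i) = Fin.partialProd (fun i => (q.2 i : G)) i := by
    intro i
    rw [transport, MulAction.mem_stabilizer_iff.1 (hmem (Fin.last n)),
      MulAction.mem_stabilizer_iff.1 (inv_mem (hmem i)), hone, mul_one]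
  change (transport t _ _)⁻¹ * transport t _ _ = _
  refine (congrArg₂ (fun a b => a⁻¹ * b) (htr i.castSucc) (htr i.succ)).trans ?_
  exact Fin.partialProd_right_inv _ i

theorem homogeneous_transport {rep : S → I} {t : S → G} (ht : ∀ s, t s • (rep s : S) = s)
    (hrep : ∀ (g : G) s, rep (g • s) = rep s) {n : ℕ} (ψ : (Fin n → G) × S → ℂ) (g : Fin n → G)
    (s : S) :
    homogeneous ψ (Fin.partialProd g (Fin.last n) • s)
        (transport t (Fin.partialProd g (Fin.last n) • s) ∘ Fin.partialProd g) =
      ψ (stabilizerIncl G I n (retract ht hrep n (g, s))) := by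
  have : (t s)⁻¹ • s = rep s := by rw [inv_smul_eq_iff, ht]
  simp only [homogeneous, stabilizerIncl, retract, Function.comp_apply]
  congr 2
  simp [transport, mul_smul, this]

end Representatives

theorem mainTheorem2 {G S : Type*} [Group G] [MulAction G S]
    (I : Set S) (hI : ∀ s : S, ∃! x : S, x ∈ I ∧ s ∈ MulAction.orbit G x) (n : ℕ) :
    Nonempty
      ((Hochschild.complex (l1.actionBimodule G S).dual).Cohomology n ≃L[ℂ]
        (l1.stabilizerComplex G I).Cohomology n) := by
  obtain ⟨rep, t, ht, hrep, hself, hone⟩ := exists_rep hI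
  have hA := l1.isBoundedFunctions_evalAction G S
  have hB := l1.isBoundedFunctions_evalFamily fun x : I => MulAction.stabilizer G (x : S)
  choose ι hι using fun n => (hA n).exists_operator (hB n)
    (LinearMap.funLeft ℂ ℂ (stabilizerIncl G I n)) 1 zero_le_one
    fun v C _ hv ω => (hv _).trans_eq (one_mul C).symm
  choose F hF using fun n => (hB n).exists_operator (hA n)
    (LinearMap.funLeft ℂ ℂ (retract ht hrep n)) 1 zero_le_one
    fun v C _ hv ω => (hv _).trans_eq (one_mul C).symm
  choose H hH using fun n => (hA (n + 1)).exists_operator (hA n) (actionPrism t n) (n + 1 : ℕ)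
    (Nat.cast_nonneg _) fun v C _ hv => norm_actionPrism_le t v C hv
  have hd : ∀ n ψ, l1.evalAction G S (n + 1)
      ((Hochschild.complex (l1.actionBimodule G S).dual).d n ψ) =
        actionCoboundary (l1.evalAction G S n ψ) := fun n ψ =>
    funext fun p => l1.evalAction_d ψ p.1 p.2
  have hFι : ∀ n ψ g s, l1.evalAction G S n (F n (ι n ψ)) (g, s) =
      homogeneous (l1.evalAction G S n ψ) (Fin.partialProd g (Fin.last n) • s)
        (transport t (Fin.partialProd g (Fin.last n) • s) ∘ Fin.partialProd g) := by
    intro n ψ g s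
    rw [homogeneous_transport ht hrep, hF, LinearMap.funLeft_apply, hι, LinearMap.funLeft_apply]
  refine BanachCochainComplex.nonempty_cohomology_equiv _ _ ι F H ?_ ?_ ?_ ?_ n
  -- In the last coface, an element of the stabilizer fixes the base point.
  · intro n ψ
    refine (hB _).injective (funext fun ⟨x, h⟩ => ?_)
    have hx : (h (Fin.last n) : G) • (x : S) = x := (h (Fin.last n)).2
    rw [l1.evalFamily_d, hι, hι, LinearMap.funLeft_apply, hd]
    simp only [LinearMap.funLeft_apply, actionCoboundary, stabilizerIncl, hx]
    congr 2
    refine Finset.sum_congr rfl fun j _ => ?_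
    refine congrArg _ (congrArg (l1.evalAction G S n ψ) (Prod.ext (funext fun k => ?_) rfl))
    simp only [Fin.contractNth]
    split_ifs <;> rfl
  · intro n φ
    refine (hB n).injective (funext fun q => ?_)
    rw [hι, LinearMap.funLeft_apply, hF, LinearMap.funLeft_apply,
      retract_stabilizerIncl ht hrep hself hone]
  · intro ψ
    refine (hA 0).injective (funext fun ⟨g, s⟩ => ?_)
    rw [map_sub, Pi.sub_apply, hFι, hH, hd, actionPrism_actionCoboundary_zero]
  · intro n ψ
    refine (hA (n + 1)).injective (funext fun ⟨g, s⟩ => ?_)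
    rw [map_sub, Pi.sub_apply, hFι, map_add, Pi.add_apply, hH, hd, hd, hH, actionPrism_add]
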